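/- Let $G=(V,E)$ be a finite simple graph and let $x=(x_e)_{e\in E}$ be nonnegative edge values. The input $(G,x)$ is called $1$-regular if $\sum_{e\ni v}x_e=1$ for every vertex $v\in V$. Each edge $e$ is active independently with probability $x_e$, and the edges are processed in a uniformly random order that is independent of the edge states. The greedy scheme selects an arriving edge exactly when it is active and shares no vertex with a previously selected edge. For $c\in\mathbb R$, it is $c$-selectable on $(G,x)$ if every $e\in E$ is selected with probability at least $c\,x_e$. Theorem. The greedy scheme is an online contention resolution scheme (on every finite simple graph it selects only active edges, the selected edges form a matching, and whether each edge is selected is decided from the edges that have arrived so far and their states), and it is $\tfrac12$-selectable in the vanishing regime for $1$-regular inputs. That is, there is a function $f$ with $\lim_{\varepsilon\downarrow 0}f(\varepsilon)=0$ such that on every $1$-regular input $(G,x)$ the greedy scheme is $\bigl(\tfrac12-f(\max_{e\in E}x_e)\bigr)$-selectable. In particular, if $(G(n),x(n))_n$ is a sequence of $1$-regular inputs for which there are $\varepsilon(n)\to0$ with $x_e(n)\le\varepsilon(n)$ for all edges $e$ of $G(n)$, then there are $c_n\to\tfrac12$ such that the greedy scheme is $c_n$-selectable on $(G(n),x(n))$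 for every $n$. -/

import Mathlib

open Finset Filter Topology

universe u

namespace RandomOrderCRS

section
variable {V : Type u} [Fintype V] [DecidableEq V] (G : SimpleGraph V) [DecidableRel G.Adj]

/-- A processing order of the edges of `G`: `σ k` is the edge that arrives in position `k`. -/
abbrev EdgeOrder : Type u := Fin (Fintype.card G.edgeSet) ≃ G.edgeSet

/-- A deterministic selection rule on `G`: given the order of arrival and the set of active edges,
the set of selected edges. -/
abbrev SelectionRule : Type u := EdgeOrder G → Finset G.edgeSet → Finset G.edgeSet

variable {G}

/-- `S` is a contention resolution scheme (for matchings) that works online: it selects active edges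
only, the selected edges form a matching, and whether each of the first `k` edges is selected is
determined by the first `k` edges and their states alone. -/
structure IsOnlineCRS (S : SelectionRule G) : Prop where
  active : ∀ σ A, S σ A ⊆ A
  matching : ∀ σ A, ∀ e ∈ S σ A, ∀ e' ∈ S σ A, ∀ v : V,
    v ∈ (e : Sym2 V) → v ∈ (e' : Sym2 V) → e = e'
  online : ∀ (σ τ : EdgeOrder G) (A B : Finset G.edgeSet) (k : ℕ),
    (∀ i, i.val < k → σ i = τ i ∧ (σ i ∈ A ↔ τ i ∈ B)) →
      ∀ i, i.val < k → (σ i ∈ S σ A ↔ τ i ∈ S τ B)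

/-- One step of the greedy rule: the arriving edge `e` is added to the current matching `M` exactly
if it is active and both of its endpoints are unmatched. -/
def greedyStep (A : Finset G.edgeSet) (M : Finset G.edgeSet) (e : G.edgeSet) :
    Finset G.edgeSet :=
  if e ∈ A ∧ ∀ v ∈ (e : Sym2 V), ∀ e' ∈ M, v ∉ (e' : Sym2 V) then insert e M else M

variable (G) in
/-- The greedy contention resolution scheme. -/
def greedyCRS : SelectionRule G :=
  fun σ A => (List.ofFn σ).foldl (greedyStep A) ∅

/-- The probability that `A` is exactly the set of active edges, when each edge `e` is active
independently with probability `x e`. -/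
noncomputable def activeSetProb (x : G.edgeSet → ℝ) (A : Finset G.edgeSet) : ℝ :=
  (∏ e ∈ A, x e) * ∏ e ∈ Aᶜ, (1 - x e)

/-- The probability that the rule `S` selects the edge `e`, when the edges are active independently
with probabilities `x` and arrive in a uniformly random order that is independent of their states. -/
noncomputable def selectionProb (x : G.edgeSet → ℝ) (S : SelectionRule G) (e : G.edgeSet) : ℝ :=
  ∑ A : Finset G.edgeSet, activeSetProb x A *
    ((#{σ : EdgeOrder G | e ∈ S σ A} : ℝ) / (Fintype.card (EdgeOrder G) : ℝ))

/-- `S` is `c`-selectable on the input `(G, x)` under uniformly random arrival order. -/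
def IsSelectable (x : G.edgeSet → ℝ) (S : SelectionRule G) (c : ℝ) : Prop :=
  ∀ e : G.edgeSet, c * x e ≤ selectionProb x S e

/-- The input `(G, x)` is 1-regular: the edge values are nonnegative, and at every vertex the values
of the incident edges sum to `1` (hence all values are at most `1`). -/
def IsOneRegular (x : G.edgeSet → ℝ) : Prop :=
  (∀ e, 0 ≤ x e) ∧ ∀ v : V, ∑ e ∈ univ.filter (fun e : G.edgeSet => v ∈ (e : Sym2 V)), x e = 1

end

/-- A sequence of inputs `(G n, x n)` has vanishing edge values. -/
def HasVanishingEdgeValues {V : ℕ → Type u} {G : (n : ℕ) → SimpleGraph (V n)}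
    (x : (n : ℕ) → (G n).edgeSet → ℝ) : Prop :=
  ∃ ε : ℕ → ℝ, Tendsto ε atTop (𝓝 0) ∧ ∀ n e, x n e ≤ ε n

end RandomOrderCRS

/-!
Let every edge arrive at an independent uniformly random time in `[0, 1]`. The edges that have
arrived by time `t` and are active then form a random set that contains each `e` independently with
probability `t * x e`, and their order is uniformly random. For a set `S` of vertices let `F S t`
(`freeAt`) be the probability that the greedy matching at time `t` leaves all of `S` unmatched.
Looking at the last edge of a random order (`sum_freeProb_sub`) and differentiating in `t`
(`hasDerivAt_activeSetExp`) gives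

  `(F S)' = - ∑ x e * F' (S ∪ e)`, the sum over the edges `e` that meet `S`,

where `F'` ignores the edge `e`, which changes the value by at most `x e`. On a 1-regular input the
edges at each vertex of `S` have total value `1`, and those inside `S` are negligible when the
values are small. Hence a set of `k` vertices satisfies approximately `F k' = - k * F (k + 1)` with
`F k 0 = 1` (`abs_deriv_freeAt_le`), no matter what the graph looks like. The solution of this
hierarchy is `F k t = (1 + t) ^ (-k)`. It is stable before time `1`: on `[0, Θ)` with `Θ ≤ 1`, each
integration of the equations improves the error from `D * (1 - t / Θ) ^ (-k)` to
`Θ * D * (1 - t / Θ) ^ (-k)`, up to a multiple of the largest edge value (`abs_freeAt_sub_le`).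

An edge `e` is selected when it is active and both its endpoints are free as it arrives. So its
selection probability is `x e` times an integral close to that of `(1 + t) ^ (-2)` over `[0, 1]`,
which is `1 / 2`; for the lower bound it is harmless to integrate over `[0, τ]` with `τ < 1` only
(`isSelectable_greedyCRS`). All error terms depend on the largest edge value alone, which gives the
error function (`greedyLoss`).

Times and orders enter only through finite sums: `orderAvg` is the average over the orders of a
finite set, `activeSetExp` the expectation over a random set of active edges, and the expectations
at time `t` are polynomials in `t`.
-/

namespace RandomOrderCRS

/-! ### Uniformly random orders of a finite set -/

section Orders

variable {α : Type*}

/-- The lists that enumerate the finite set `D` without repetition. -/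
def orders (D : Finset α) : Finset (List α) := ⟨D.val.lists, Multiset.lists_nodup_finset D⟩

theorem mem_orders {D : Finset α} {l : List α} : l ∈ orders D ↔ D.val = (l : Multiset α) := by
  rw [orders, Finset.mem_mk, Multiset.mem_lists_iff]; rfl

theorem mem_iff_of_mem_orders {D : Finset α} {l : List α} (h : l ∈ orders D) {a : α} :
    a ∈ l ↔ a ∈ D := by
  rw [← Finset.mem_val, mem_orders.1 h, Multiset.mem_coe]

theorem nodup_of_mem_orders {D : Finset α} {l : List α} (h : l ∈ orders D) : l.Nodup := by
  rw [← Multiset.coe_nodup, ← mem_orders.1 h]; exact D.nodup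

/-- The average of `φ` over a uniformly random order of the finite set `D`. -/
noncomputable def orderAvg (D : Finset α) (φ : List α → ℝ) : ℝ :=
  (∑ l ∈ orders D, φ l) / ((#D).factorial : ℝ)

theorem orderAvg_congr {D : Finset α} {φ ψ : List α → ℝ} (h : ∀ l ∈ orders D, φ l = ψ l) :
    orderAvg D φ = orderAvg D ψ := by
  rw [orderAvg, orderAvg, Finset.sum_congr rfl h]

theorem orderAvg_nonneg {D : Finset α} {φ : List α → ℝ} (h : ∀ l ∈ orders D, 0 ≤ φ l) :
    0 ≤ orderAvg D φ :=
  div_nonneg (Finset.sum_nonneg h) (Nat.cast_nonneg _)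

theorem orderAvg_eq_zero {D : Finset α} {φ : List α → ℝ} (h : ∀ l ∈ orders D, φ l = 0) :
    orderAvg D φ = 0 := by
  rw [orderAvg, Finset.sum_eq_zero h, zero_div]

theorem orderAvg_neg (D : Finset α) (φ : List α → ℝ) :
    orderAvg D (fun l => - φ l) = - orderAvg D φ := by
  simp only [orderAvg, Finset.sum_neg_distrib, neg_div]

theorem orderAvg_sub (D : Finset α) (φ ψ : List α → ℝ) :
    orderAvg D (fun l => φ l - ψ l) = orderAvg D φ - orderAvg D ψ := by
  simp only [orderAvg, Finset.sum_sub_distrib, sub_div]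

variable [DecidableEq α]

/-- Splitting the orders of `D` by their last element. -/
theorem sum_orders {D : Finset α} (hD : D.Nonempty) (φ : List α → ℝ) :
    ∑ l ∈ orders D, φ l = ∑ a ∈ D, ∑ l ∈ orders (D.erase a), φ (l ++ [a]) := by
  rw [Finset.sum_sigma']
  symm
  refine Finset.sum_bij (fun p _ => p.2 ++ [p.1]) ?_ ?_ ?_ (fun _ _ => rfl)
  · rintro ⟨a, l⟩ h
    rw [Finset.mem_sigma] at h
    have h2 := mem_orders.1 h.2
    rw [mem_orders]
    rw [Finset.erase_val] at h2
    rw [← Multiset.coe_add, ← h2, Multiset.coe_singleton, add_comm, Multiset.singleton_add,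
      Multiset.cons_erase h.1]
  · rintro ⟨a, l⟩ _ ⟨b, m⟩ _ h
    obtain ⟨h1, h2⟩ := List.append_inj' h rfl
    simp only [List.cons.injEq, and_true] at h2
    simp only at h1
    subst h1 h2
    rfl
  · intro l hl
    rcases List.eq_nil_or_concat l with rfl | ⟨m, a, rfl⟩
    · obtain ⟨a, ha⟩ := hD
      exact absurd ((mem_iff_of_mem_orders hl).2 ha) (by simp)
    · have haD : a ∈ D := (mem_iff_of_mem_orders hl).1 (by simp)
      refine ⟨⟨a, m⟩, ?_, by simp⟩
      rw [Finset.mem_sigma]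
      refine ⟨haD, ?_⟩
      rw [mem_orders, Finset.erase_val, mem_orders.1 hl, List.concat_eq_append,
        ← Multiset.coe_add, Multiset.coe_singleton, add_comm, Multiset.singleton_add,
        Multiset.erase_cons_head]

theorem card_orders (D : Finset α) : #(orders D) = (#D).factorial := by
  have key : ∀ n, ∀ D : Finset α, #D = n → (#(orders D) : ℝ) = n.factorial := by
    intro n
    induction n with
    | zero =>
      intro D hD
      rw [Finset.card_eq_zero] at hD
      subst hD
      have : orders (∅ : Finset α) = {[]} := by
        ext l
        rw [mem_orders, Finset.mem_singleton, Finset.empty_val, eq_comm, Multiset.coe_eq_zero]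
      simp [this]
    | succ n ih =>
      intro D hD
      have hne : D.Nonempty := Finset.card_pos.1 (by omega)
      have h := sum_orders hne (fun _ => (1 : ℝ))
      have hr : ∀ a ∈ D, ∑ l ∈ orders (D.erase a), (1 : ℝ) = n.factorial := fun a ha => by
        rw [Finset.sum_const, nsmul_one,
          ih (D.erase a) (by rw [Finset.card_erase_of_mem ha]; omega)]
      rw [Finset.sum_congr rfl hr, Finset.sum_const, nsmul_one, Finset.sum_const, hD,
        nsmul_eq_mul] at h
      rw [h, Nat.factorial_succ]
      push_cast
      ring
  exact_mod_cast key _ D rfl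

theorem orderAvg_le_one {D : Finset α} {φ : List α → ℝ} (h : ∀ l ∈ orders D, φ l ≤ 1) :
    orderAvg D φ ≤ 1 := by
  rw [orderAvg, div_le_one (by positivity), ← card_orders]
  simpa using Finset.sum_le_sum h

/-- The last element of a uniformly random order of `D` is uniform on `D`, and the elements before
it are in uniformly random order. -/
theorem card_mul_orderAvg (D : Finset α) (φ : List α → ℝ) :
    (#D : ℝ) * orderAvg D φ = ∑ a ∈ D, orderAvg (D.erase a) (fun l => φ (l ++ [a])) := by
  rcases D.eq_empty_or_nonempty with rfl | hD
  · simp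
  obtain ⟨n, hn⟩ : ∃ n, #D = n + 1 := ⟨#D - 1, by have := hD.card_pos; omega⟩
  have hr : ∀ a ∈ D, orderAvg (D.erase a) (fun l => φ (l ++ [a]))
      = (∑ l ∈ orders (D.erase a), φ (l ++ [a])) / (n.factorial : ℝ) := by
    intro a ha
    rw [orderAvg, Finset.card_erase_of_mem ha, hn, Nat.add_sub_cancel]
  rw [Finset.sum_congr rfl hr, ← Finset.sum_div, ← sum_orders hD, orderAvg, hn,
    Nat.factorial_succ]
  have h1 : ((n : ℝ) + 1) ≠ 0 := by positivity
  have h2 : (n.factorial : ℝ) ≠ 0 := by positivity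
  push_cast
  field_simp

/-- A uniformly random order of `D` induces a uniformly random order of `D ∩ A`. -/
theorem orderAvg_filter (A D : Finset α) (φ : List α → ℝ) :
    orderAvg D (fun l => φ (l.filter (· ∈ A))) = orderAvg (D ∩ A) φ := by
  induction hn : #D generalizing D φ with
  | zero =>
    rw [Finset.card_eq_zero] at hn
    subst hn
    rw [Finset.empty_inter]
    refine orderAvg_congr fun l hl => ?_
    have : l = [] := List.eq_nil_iff_forall_not_mem.2
      fun a ha => by simpa using (mem_iff_of_mem_orders hl).1 ha
    simp [this]
  | succ n ih =>
    have hpos : (#D : ℝ) ≠ 0 := by rw [hn]; positivity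
    have hcard : ∀ a ∈ D, #(D.erase a) = n := fun a ha => by
      rw [Finset.card_erase_of_mem ha, hn, Nat.add_sub_cancel]
    apply mul_left_cancel₀ hpos
    rw [card_mul_orderAvg, ← Finset.sum_filter_add_sum_filter_not D (· ∈ A),
      Finset.filter_mem_eq_inter]
    have h1 : ∀ a ∈ D ∩ A, orderAvg (D.erase a) (fun l => φ ((l ++ [a]).filter (· ∈ A)))
        = orderAvg ((D ∩ A).erase a) (fun l => φ (l ++ [a])) := by
      intro a ha
      rw [Finset.mem_inter] at ha
      rw [← Finset.erase_inter, ← ih (D.erase a) _ (hcard a ha.1)]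
      exact orderAvg_congr fun l _ => by simp [List.filter_append, ha.2]
    have h2 : ∀ a ∈ D.filter (· ∉ A),
        orderAvg (D.erase a) (fun l => φ ((l ++ [a]).filter (· ∈ A))) = orderAvg (D ∩ A) φ := by
      intro a ha
      rw [Finset.mem_filter] at ha
      have he : D ∩ A = D.erase a ∩ A := by
        rw [Finset.erase_inter, Finset.erase_eq_of_notMem (by simp [ha.2])]
      rw [he, ← ih (D.erase a) _ (hcard a ha.1)]
      exact orderAvg_congr fun l _ => by simp [List.filter_append, ha.2]
    rw [Finset.sum_congr rfl h1, Finset.sum_congr rfl h2, ← card_mul_orderAvg, Finset.sum_const,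
      nsmul_eq_mul, ← add_mul, ← Nat.cast_add, ← Finset.filter_mem_eq_inter,
      Finset.card_filter_add_card_filter_not]

/-- Enumerations of a finite type by `Fin` are the same as orders of `univ`. -/
theorem card_filter_equiv_div_card [Fintype α] (P : List α → Prop) [DecidablePred P] :
    (#{σ : Fin (Fintype.card α) ≃ α | P (List.ofFn σ)} : ℝ)
        / (Fintype.card (Fin (Fintype.card α) ≃ α) : ℝ)
      = orderAvg univ (fun l => if P l then 1 else 0) := by
  have hc : Fintype.card (Fin (Fintype.card α) ≃ α) = (Fintype.card α).factorial := by
    rw [Fintype.card_equiv (Fintype.equivFin α).symm, Fintype.card_fin]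
  rw [orderAvg, Finset.card_univ, hc, Finset.card_filter]
  push_cast
  congr 1
  refine Finset.sum_bij (fun σ _ => List.ofFn σ) ?_ ?_ ?_ (fun _ _ => rfl)
  · intro σ _
    rw [mem_orders]
    have hnd : (List.ofFn σ : List α).Nodup := List.nodup_ofFn.2 σ.injective
    rw [Multiset.Nodup.ext Finset.univ.nodup (Multiset.coe_nodup.2 hnd)]
    intro a
    simp [List.mem_ofFn']
  · intro σ _ τ _ h
    exact DFunLike.coe_injective (List.ofFn_injective h)
  · intro l hl
    have hm : ∀ a, a ∈ l := fun a => (mem_iff_of_mem_orders hl).2 (mem_univ a)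
    have hlen : l.length = Fintype.card α := by
      have := congrArg Multiset.card (mem_orders.1 hl)
      rw [Multiset.coe_card] at this
      exact this.symm
    refine ⟨(finCongr hlen.symm).trans
      (List.Nodup.getEquivOfForallMemList l (nodup_of_mem_orders hl) hm), mem_univ _, ?_⟩
    apply List.ext_getElem
    · simp [hlen]
    · intro i h1 h2
      simp

end Orders

/-! ### Expectations over a random active set -/

section Expectation

variable {V : Type u} [Fintype V] [DecidableEq V] {G : SimpleGraph V} [DecidableRel G.Adj]

/-- The expectation of `g` evaluated at the random set of active edges, when each edge `e` is active
independently with probability `y e`. -/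
noncomputable def activeSetExp (y : G.edgeSet → ℝ) (g : Finset G.edgeSet → ℝ) : ℝ :=
  ∑ A : Finset G.edgeSet, activeSetProb y A * g A

theorem activeSetProb_eq_prod (y : G.edgeSet → ℝ) (A : Finset G.edgeSet) :
    activeSetProb y A = ∏ e, if e ∈ A then y e else 1 - y e := by
  rw [activeSetProb, ← Finset.prod_mul_prod_compl A]
  congr 1
  · exact Finset.prod_congr rfl fun e he => by rw [if_pos he]
  · exact Finset.prod_congr rfl fun e he => by rw [if_neg (Finset.mem_compl.1 he)]

theorem activeSetProb_nonneg {y : G.edgeSet → ℝ} (h0 : ∀ e, 0 ≤ y e) (h1 : ∀ e, y e ≤ 1)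
    (A : Finset G.edgeSet) : 0 ≤ activeSetProb y A :=
  mul_nonneg (Finset.prod_nonneg fun e _ => h0 e)
    (Finset.prod_nonneg fun e _ => sub_nonneg.2 (h1 e))

theorem sum_activeSetProb (y : G.edgeSet → ℝ) : ∑ A, activeSetProb y A = 1 := by
  simp only [activeSetProb]
  rw [← Fintype.prod_add]
  simp

/-- The probability of a set, with the factor of a given edge `e` singled out. -/
theorem prod_erase_eq_activeSetProb (y : G.edgeSet → ℝ) (A : Finset G.edgeSet) (e : G.edgeSet) :
    (∏ e' ∈ univ.erase e, if e' ∈ A then y e' else 1 - y e')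
      = activeSetProb (Function.update y e 0) (A.erase e) := by
  rw [activeSetProb_eq_prod, ← Finset.mul_prod_erase univ _ (mem_univ e)]
  simp only [Finset.notMem_erase, if_false, Function.update_self, sub_zero, one_mul]
  refine Finset.prod_congr rfl fun e' he' => ?_
  have hne : e' ≠ e := Finset.ne_of_mem_erase he'
  simp [hne]

theorem activeSetProb_eq_mul (y : G.edgeSet → ℝ) (A : Finset G.edgeSet) (e : G.edgeSet) :
    activeSetProb y A = (if e ∈ A then y e else 1 - y e) *
      activeSetProb (Function.update y e 0) (A.erase e) := by
  rw [← prod_erase_eq_activeSetProb, activeSetProb_eq_prod, Finset.mul_prod_erase univ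
    (fun e' => if e' ∈ A then y e' else 1 - y e') (mem_univ e)]

theorem activeSetProb_update_zero (y : G.edgeSet → ℝ) {A : Finset G.edgeSet} {e : G.edgeSet}
    (he : e ∈ A) : activeSetProb (Function.update y e 0) A = 0 := by
  rw [activeSetProb, Finset.prod_eq_zero he (by simp), zero_mul]

theorem activeSetExp_nonneg {y : G.edgeSet → ℝ} (h0 : ∀ e, 0 ≤ y e) (h1 : ∀ e, y e ≤ 1)
    {g : Finset G.edgeSet → ℝ} (hg : ∀ A, 0 ≤ g A) : 0 ≤ activeSetExp y g :=
  Finset.sum_nonneg fun A _ => mul_nonneg (activeSetProb_nonneg h0 h1 A) (hg A)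

theorem activeSetExp_le_one {y : G.edgeSet → ℝ} (h0 : ∀ e, 0 ≤ y e) (h1 : ∀ e, y e ≤ 1)
    {g : Finset G.edgeSet → ℝ} (hg : ∀ A, g A ≤ 1) : activeSetExp y g ≤ 1 := by
  rw [← sum_activeSetProb y]
  exact Finset.sum_le_sum fun A _ =>
    mul_le_of_le_one_right (activeSetProb_nonneg h0 h1 A) (hg A)

/-- With all activation probabilities zero, the active set is empty. -/
theorem activeSetExp_zero (g : Finset G.edgeSet → ℝ) :
    activeSetExp (fun _ => 0) g = g ∅ := by
  rw [activeSetExp, Finset.sum_eq_single ∅]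
  · simp [activeSetProb]
  · intro A _ hA
    obtain ⟨e, he⟩ := Finset.nonempty_iff_ne_empty.2 hA
    rw [activeSetProb, Finset.prod_eq_zero he rfl, zero_mul, zero_mul]
  · simp

/-- If `g` vanishes as soon as `e` is active, then conditioning on `e` being inactive divides the
expectation of `g` by the probability of that event. -/
theorem activeSetExp_eq_mul_update (y : G.edgeSet → ℝ) {g : Finset G.edgeSet → ℝ} {e : G.edgeSet}
    (hg : ∀ A, e ∈ A → g A = 0) :
    activeSetExp y g = (1 - y e) * activeSetExp (Function.update y e 0) g := by
  rw [activeSetExp, activeSetExp, Finset.mul_sum]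
  refine Finset.sum_congr rfl fun A _ => ?_
  by_cases he : e ∈ A
  · rw [hg A he]; ring
  · rw [activeSetProb_eq_mul y A e, if_neg he, Finset.erase_eq_of_notMem he]; ring

theorem sum_filter_mem_erase (e : G.edgeSet) (f : Finset G.edgeSet → ℝ) :
    ∑ A ∈ univ.filter (fun A : Finset G.edgeSet => e ∈ A), f (A.erase e)
      = ∑ A ∈ univ.filter (fun A : Finset G.edgeSet => e ∉ A), f A := by
  refine Finset.sum_bij' (fun A _ => A.erase e) (fun A _ => insert e A) ?_ ?_ ?_ ?_ ?_
  · intro A _; simp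
  · intro A _; simp
  · intro A hA; exact Finset.insert_erase (Finset.mem_filter.1 hA).2
  · intro A hA; exact Finset.erase_insert (Finset.mem_filter.1 hA).2
  · intro A _; rfl

theorem sum_filter_mem_eq_activeSetExp (y : G.edgeSet → ℝ) (e : G.edgeSet)
    (f : Finset G.edgeSet → ℝ) :
    ∑ A ∈ univ.filter (fun A : Finset G.edgeSet => e ∈ A),
        activeSetProb (Function.update y e 0) (A.erase e) * f (A.erase e)
      = activeSetExp (Function.update y e 0) f := by
  rw [sum_filter_mem_erase e (fun A => activeSetProb (Function.update y e 0) A * f A),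
    activeSetExp, ← Finset.sum_filter_add_sum_filter_not univ
      (fun A : Finset G.edgeSet => e ∈ A)]
  have h0 : ∑ A ∈ univ.filter (fun A : Finset G.edgeSet => e ∈ A),
      activeSetProb (Function.update y e 0) A * f A = 0 :=
    Finset.sum_eq_zero fun A hA => by
      rw [activeSetProb_update_zero y (Finset.mem_filter.1 hA).2, zero_mul]
  rw [h0, zero_add]

theorem hasDerivAt_activeSetProb (x : G.edgeSet → ℝ) (A : Finset G.edgeSet) (t : ℝ) :
    HasDerivAt (fun s : ℝ => activeSetProb (fun e => s * x e) A)
      (∑ e, activeSetProb (Function.update (fun e => t * x e) e 0) (A.erase e) *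
        (if e ∈ A then x e else - x e)) t := by
  have h : ∀ e ∈ (univ : Finset G.edgeSet),
      HasDerivAt (fun s : ℝ => if e ∈ A then s * x e else 1 - s * x e)
        (if e ∈ A then x e else - x e) t := by
    intro e _
    have h1 : HasDerivAt (fun s : ℝ => s * x e) (x e) t := by
      simpa using (hasDerivAt_id t).mul_const (x e)
    split_ifs
    · exact h1
    · simpa using h1.const_sub 1
  have h2 := HasDerivAt.fun_finsetProd h
  have h3 : (fun s : ℝ => activeSetProb (fun e => s * x e) A)
      = fun s => ∏ e, if e ∈ A then s * x e else 1 - s * x e :=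
    funext fun s => activeSetProb_eq_prod _ A
  rw [h3]
  refine h2.congr_deriv (Finset.sum_congr rfl fun e _ => ?_)
  rw [prod_erase_eq_activeSetProb (fun e => t * x e), smul_eq_mul]

/-- Russo-type formula. Let the set `A` of edges that are active and have arrived by time `t`
contain each edge `e` independently with probability `t * x e`. If, on average over a uniformly
chosen last edge `e ∈ A`, the edge `e` increases `g` by the value of `h e` at the set of the other
edges, then the expectation of `g` changes at the rate `∑ x e * E (h e)`, where `E` is the
expectation with `e` excluded from `A`. -/
theorem hasDerivAt_activeSetExp (x : G.edgeSet → ℝ) {g : Finset G.edgeSet → ℝ}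
    {h : G.edgeSet → Finset G.edgeSet → ℝ}
    (hgh : ∀ A, ∑ e ∈ A, (g A - g (A.erase e)) = ∑ e ∈ A, h e (A.erase e)) (t : ℝ) :
    HasDerivAt (fun s : ℝ => activeSetExp (fun e => s * x e) g)
      (∑ e, x e * activeSetExp (Function.update (fun e => t * x e) e 0) (h e)) t := by
  set w : G.edgeSet → Finset G.edgeSet → ℝ :=
    fun e A => activeSetProb (Function.update (fun e => t * x e) e 0) A with hw
  have h1 : HasDerivAt (fun s : ℝ => activeSetExp (fun e => s * x e) g)
      (∑ A, (∑ e, w e (A.erase e) * (if e ∈ A then x e else - x e)) * g A) t :=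
    HasDerivAt.fun_sum fun A _ => (hasDerivAt_activeSetProb x A t).mul_const (g A)
  convert h1 using 1
  -- the weight `x e * w e (A.erase e)` does not depend on the choice of `e ∈ A`
  have hc : ∀ A : Finset G.edgeSet, ∀ e ∈ A, x e * w e (A.erase e)
      = t ^ (#A - 1) * (∏ e ∈ A, x e) * ∏ e ∈ Aᶜ, (1 - t * x e) := by
    intro A e he
    have hA : insert e Aᶜ = (A.erase e)ᶜ := by rw [Finset.compl_erase]
    have hp1 : ∏ e' ∈ A.erase e, Function.update (fun e => t * x e) e 0 e'
        = ∏ e' ∈ A.erase e, t * x e' :=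
      Finset.prod_congr rfl fun e' he' => by
        rw [Function.update_of_ne (Finset.ne_of_mem_erase he')]
    have hp2 : ∏ e' ∈ Aᶜ, (1 - Function.update (fun e => t * x e) e 0 e')
        = ∏ e' ∈ Aᶜ, (1 - t * x e') :=
      Finset.prod_congr rfl fun e' he' => by
        have : e' ≠ e := fun h => Finset.mem_compl.1 he' (h ▸ he)
        rw [Function.update_of_ne this]
    simp only [hw, activeSetProb]
    rw [← hA, Finset.prod_insert (by simp [he]), hp1, hp2, Function.update_self,
      Finset.prod_mul_distrib, Finset.prod_const, Finset.card_erase_of_mem he,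
      ← Finset.mul_prod_erase A x he]
    ring
  have hL : ∑ e, x e * activeSetExp (Function.update (fun e => t * x e) e 0) (h e)
      = ∑ A : Finset G.edgeSet, ∑ e ∈ A, x e * w e (A.erase e) * h e (A.erase e) := by
    simp only [← sum_filter_mem_eq_activeSetExp, Finset.mul_sum]
    simp only [Finset.sum_filter]
    rw [Finset.sum_comm]
    refine Finset.sum_congr rfl fun A _ => ?_
    rw [← Finset.sum_filter, Finset.filter_mem_eq_inter, Finset.univ_inter]
    exact Finset.sum_congr rfl fun e _ => by rw [hw]; ring
  have hR : ∑ A : Finset G.edgeSet, (∑ e, w e (A.erase e) * (if e ∈ A then x e else - x e)) * g A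
      = ∑ A : Finset G.edgeSet, ∑ e ∈ A, x e * w e (A.erase e) * (g A - g (A.erase e)) := by
    have e1 : ∀ e : G.edgeSet,
        ∑ A : Finset G.edgeSet, w e (A.erase e) * (if e ∈ A then x e else - x e) * g A
        = ∑ A ∈ univ.filter (fun A : Finset G.edgeSet => e ∈ A),
            x e * w e (A.erase e) * (g A - g (A.erase e)) := by
      intro e
      have e2 := sum_filter_mem_erase e (fun A => x e * w e A * g A)
      rw [← Finset.sum_filter_add_sum_filter_not univ (fun A : Finset G.edgeSet => e ∈ A)]
      have e3 : ∑ A ∈ univ.filter (fun A : Finset G.edgeSet => e ∉ A),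
          w e (A.erase e) * (if e ∈ A then x e else - x e) * g A
          = - ∑ A ∈ univ.filter (fun A : Finset G.edgeSet => e ∉ A), x e * w e A * g A := by
        rw [← Finset.sum_neg_distrib]
        refine Finset.sum_congr rfl fun A hA => ?_
        have := (Finset.mem_filter.1 hA).2
        rw [if_neg this, Finset.erase_eq_of_notMem this]
        ring
      rw [e3, ← e2, ← sub_eq_add_neg, ← Finset.sum_sub_distrib]
      refine Finset.sum_congr rfl fun A hA => ?_
      rw [if_pos (Finset.mem_filter.1 hA).2]
      ring
    simp only [Finset.sum_mul]
    rw [Finset.sum_comm, Finset.sum_congr rfl fun e _ => e1 e]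
    simp only [Finset.sum_filter]
    rw [Finset.sum_comm]
    refine Finset.sum_congr rfl fun A _ => ?_
    rw [← Finset.sum_filter, Finset.filter_mem_eq_inter, Finset.univ_inter]
  rw [hL, hR]
  refine Finset.sum_congr rfl fun A _ => ?_
  have hsum : ∀ f : G.edgeSet → ℝ, ∑ e ∈ A, x e * w e (A.erase e) * f e
      = t ^ (#A - 1) * (∏ e ∈ A, x e) * (∏ e ∈ Aᶜ, (1 - t * x e)) * ∑ e ∈ A, f e := by
    intro f
    rw [Finset.mul_sum]
    exact Finset.sum_congr rfl fun e he => by rw [hc A e he]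
  rw [hsum (fun e => h e (A.erase e)), hsum (fun e => g A - g (A.erase e)), hgh]

end Expectation

/-! ### The greedy matching -/

section Free

variable {V : Type u} {G : SimpleGraph V}

/-- The edge set `M` leaves every vertex of `S` unmatched. -/
def IsFree (M : Finset G.edgeSet) (S : Finset V) : Prop :=
  ∀ v ∈ S, ∀ e ∈ M, v ∉ (e : Sym2 V)

theorem IsFree.mono {M N : Finset G.edgeSet} {S T : Finset V} (h : IsFree N T) (hM : M ⊆ N)
    (hS : S ⊆ T) : IsFree M S := fun v hv e he => h v (hS hv) e (hM he)

variable [DecidableEq V]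

instance (M : Finset G.edgeSet) (S : Finset V) : Decidable (IsFree M S) := by
  unfold IsFree; infer_instance

theorem isFree_union {M : Finset G.edgeSet} {S T : Finset V} :
    IsFree M (S ∪ T) ↔ IsFree M S ∧ IsFree M T := by
  simp only [IsFree, Finset.mem_union, or_imp, forall_and]

theorem not_isFree_of_mem {M : Finset G.edgeSet} {e : G.edgeSet} (he : e ∈ M) :
    ¬ IsFree M (e : Sym2 V).toFinset := fun h =>
  h _ (Sym2.mem_toFinset.2 (Sym2.out_fst_mem (e : Sym2 V))) e he (Sym2.out_fst_mem _)

theorem isFree_insert {M : Finset G.edgeSet} {S : Finset V} {e : G.edgeSet} :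
    IsFree (insert e M) S ↔ Disjoint S (e : Sym2 V).toFinset ∧ IsFree M S := by
  simp only [IsFree, Finset.mem_insert, forall_eq_or_imp, Finset.disjoint_left, Sym2.mem_toFinset,
    forall_and]

end Free

section Greedy

variable {V : Type u} [Fintype V] [DecidableEq V] {G : SimpleGraph V} [DecidableRel G.Adj]

theorem greedyStep_eq (A M : Finset G.edgeSet) (e : G.edgeSet) :
    greedyStep A M e = if e ∈ A ∧ IsFree M (e : Sym2 V).toFinset then insert e M else M := by
  simp only [greedyStep, IsFree, Sym2.mem_toFinset]

theorem subset_greedyStep (A M : Finset G.edgeSet) (e : G.edgeSet) : M ⊆ greedyStep A M e := by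
  rw [greedyStep_eq]
  split_ifs
  · exact Finset.subset_insert e M
  · exact subset_rfl

/-! ### The greedy rule is an online contention resolution scheme -/

theorem mem_foldl_greedyStep {A : Finset G.edgeSet} {l : List G.edgeSet} {M : Finset G.edgeSet}
    {e : G.edgeSet} (h : e ∈ l.foldl (greedyStep A) M) : e ∈ M ∨ e ∈ A ∧ e ∈ l := by
  induction l generalizing M with
  | nil => exact Or.inl h
  | cons a l ih =>
    rcases ih h with h1 | h1
    · rw [greedyStep_eq] at h1
      split_ifs at h1 with hc
      · rcases Finset.mem_insert.1 h1 with rfl | h2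
        · exact Or.inr ⟨hc.1, by simp⟩
        · exact Or.inl h2
      · exact Or.inl h1
    · exact Or.inr ⟨h1.1, by simp [h1.2]⟩

theorem subset_foldl_greedyStep (A : Finset G.edgeSet) (l : List G.edgeSet)
    (M : Finset G.edgeSet) : M ⊆ l.foldl (greedyStep A) M := by
  induction l generalizing M with
  | nil => exact subset_rfl
  | cons a l ih => exact (subset_greedyStep A M a).trans (ih _)

theorem matching_foldl_greedyStep (A : Finset G.edgeSet) (l : List G.edgeSet)
    {M : Finset G.edgeSet} (hM : ∀ e ∈ M, ∀ e' ∈ M, ∀ v : V,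
      v ∈ (e : Sym2 V) → v ∈ (e' : Sym2 V) → e = e') :
    ∀ e ∈ l.foldl (greedyStep A) M, ∀ e' ∈ l.foldl (greedyStep A) M, ∀ v : V,
      v ∈ (e : Sym2 V) → v ∈ (e' : Sym2 V) → e = e' := by
  induction l generalizing M with
  | nil => exact hM
  | cons a l ih =>
    refine ih ?_
    rw [greedyStep]
    split_ifs with hc
    · intro e he e' he' v hv hv'
      rcases Finset.mem_insert.1 he with rfl | h1 <;> rcases Finset.mem_insert.1 he' with rfl | h2
      · rfl
      · exact absurd hv' (hc.2 v hv e' h2)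
      · exact absurd hv (hc.2 v hv' e h1)
      · exact hM e h1 e' h2 v hv hv'
    · exact hM

theorem foldl_greedyStep_congr {A B : Finset G.edgeSet} {l : List G.edgeSet}
    (h : ∀ e ∈ l, (e ∈ A ↔ e ∈ B)) (M : Finset G.edgeSet) :
    l.foldl (greedyStep A) M = l.foldl (greedyStep B) M := by
  induction l generalizing M with
  | nil => rfl
  | cons a l ih =>
    rw [List.foldl_cons, List.foldl_cons, ih fun e he => h e (by simp [he]), greedyStep_eq,
      greedyStep_eq]
    simp only [h a (by simp)]

/-- Whether one of the first `k` edges is selected is decided within the first `k` steps. -/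
theorem mem_greedyCRS_iff (σ : EdgeOrder G) (A : Finset G.edgeSet) {k : ℕ}
    {i : Fin (Fintype.card G.edgeSet)} (hi : i.val < k) :
    σ i ∈ greedyCRS G σ A ↔ σ i ∈ ((List.ofFn σ).take k).foldl (greedyStep A) ∅ := by
  have hnd : (List.ofFn σ).Nodup := List.nodup_ofFn.2 σ.injective
  have hsplit := List.take_append_drop k (List.ofFn σ)
  rw [greedyCRS]
  constructor
  · intro h
    rw [← hsplit, List.foldl_append] at h
    rcases mem_foldl_greedyStep h with h1 | h1
    · exact h1
    · exfalso
      have hmem : σ i ∈ (List.ofFn σ).take k := by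
        rw [List.mem_take_iff_getElem]
        refine ⟨i, ?_, by simp⟩
        rw [List.length_ofFn]
        exact lt_min hi i.isLt
      rw [← hsplit] at hnd
      exact (List.disjoint_of_nodup_append hnd) hmem h1.2
  · intro h
    rw [← hsplit, List.foldl_append]
    exact subset_foldl_greedyStep _ _ _ h

theorem isOnlineCRS_greedyCRS : IsOnlineCRS (greedyCRS G) where
  active σ A e he := by
    rcases mem_foldl_greedyStep he with h | h
    · simp at h
    · exact h.1
  matching σ A := matching_foldl_greedyStep A _ (by simp)
  online σ τ A B k h i hi := by
    rw [mem_greedyCRS_iff σ A hi, mem_greedyCRS_iff τ B hi]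
    have htake : (List.ofFn σ).take k = (List.ofFn τ).take k := by
      apply List.ext_getElem
      · simp
      · intro j h1 h2
        simp only [List.length_take, List.length_ofFn, lt_min_iff] at h1
        simpa using (h ⟨j, h1.2⟩ h1.1).1
    have hcongr : ∀ e ∈ (List.ofFn τ).take k, (e ∈ A ↔ e ∈ B) := by
      intro e he
      rw [List.mem_take_iff_getElem] at he
      obtain ⟨j, hj, rfl⟩ := he
      simp only [List.length_ofFn, lt_min_iff] at hj
      have := h ⟨j, hj.2⟩ hj.1
      rw [this.1] at this
      simpa using this.2
    rw [htake, foldl_greedyStep_congr hcongr, (h i hi).1]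

/-! ### Last-edge recursions for the greedy matching -/

/-- The greedy matching when all the edges of the list `l` are active. -/
def greedyRun (l : List G.edgeSet) : Finset G.edgeSet := l.foldl (greedyStep univ) ∅

theorem foldl_greedyStep_eq_greedyRun (A : Finset G.edgeSet) (l : List G.edgeSet) :
    l.foldl (greedyStep A) ∅ = greedyRun (l.filter (· ∈ A)) := by
  rw [greedyRun]
  generalize (∅ : Finset G.edgeSet) = M
  induction l generalizing M with
  | nil => rfl
  | cons a l ih =>
    by_cases ha : a ∈ A
    · rw [List.filter_cons_of_pos (by simpa using ha), List.foldl_cons, List.foldl_cons, ih]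
      simp [greedyStep_eq, ha]
    · rw [List.filter_cons_of_neg (by simpa using ha), List.foldl_cons, ih]
      simp [greedyStep_eq, ha]

theorem greedyRun_append (l : List G.edgeSet) (e : G.edgeSet) :
    greedyRun (l ++ [e]) =
      if IsFree (greedyRun l) (e : Sym2 V).toFinset then insert e (greedyRun l)
      else greedyRun l := by
  rw [greedyRun, List.foldl_append, List.foldl_cons, List.foldl_nil, greedyStep_eq]
  by_cases h : IsFree (greedyRun l) (e : Sym2 V).toFinset
  · rw [if_pos ⟨mem_univ e, h⟩, if_pos h, greedyRun]
  · rw [if_neg fun h' => h h'.2, if_neg h, greedyRun]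

theorem mem_of_mem_greedyRun {l : List G.edgeSet} {e : G.edgeSet} (h : e ∈ greedyRun l) :
    e ∈ l := by
  rcases mem_foldl_greedyStep h with h | h
  · simp at h
  · exact h.2

/-- The greedy matching is maximal. -/
theorem not_isFree_greedyRun {l : List G.edgeSet} {e : G.edgeSet} (h : e ∈ l) :
    ¬ IsFree (greedyRun l) (e : Sym2 V).toFinset := by
  induction l using List.reverseRecOn with
  | nil => simp at h
  | append_singleton l a ih =>
    rw [greedyRun_append]
    rcases List.mem_append.1 h with h1 | h1
    · split_ifs
      · exact fun h2 => ih h1 (h2.mono (Finset.subset_insert _ _) subset_rfl)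
      · exact ih h1
    · rw [List.mem_singleton] at h1
      subst h1
      split_ifs with hc
      · exact not_isFree_of_mem (Finset.mem_insert_self _ _)
      · exact hc

/-- The probability that the greedy matching leaves all vertices of `S` unmatched, when exactly the
edges of `A` are active and they arrive in uniformly random order. -/
noncomputable def freeProb (S : Finset V) (A : Finset G.edgeSet) : ℝ :=
  orderAvg A (fun l => if IsFree (greedyRun l) S then 1 else 0)

/-- The probability that the greedy matching contains `e`, when exactly the edges of `A` are active
and they arrive in uniformly random order. -/
noncomputable def matchProb (e : G.edgeSet) (A : Finset G.edgeSet) : ℝ :=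
  orderAvg A (fun l => if e ∈ greedyRun l then 1 else 0)

theorem freeProb_nonneg (S : Finset V) (A : Finset G.edgeSet) : 0 ≤ freeProb S A :=
  orderAvg_nonneg fun l _ => by split_ifs <;> norm_num

theorem freeProb_le_one (S : Finset V) (A : Finset G.edgeSet) : freeProb S A ≤ 1 :=
  orderAvg_le_one fun l _ => by split_ifs <;> norm_num

theorem freeProb_empty (S : Finset V) : freeProb S (∅ : Finset G.edgeSet) = 1 := by
  have h : ∀ l ∈ orders (∅ : Finset G.edgeSet),
      (if IsFree (greedyRun l) S then (1 : ℝ) else 0) = 1 := by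
    intro l hl
    have : l = [] := List.eq_nil_iff_forall_not_mem.2
      fun a ha => by simpa using (mem_iff_of_mem_orders hl).1 ha
    rw [this, if_pos (by simp [IsFree, greedyRun])]
  rw [freeProb, orderAvg, Finset.sum_congr rfl h, Finset.sum_const, card_orders]
  simp

theorem freeProb_eq_zero {S : Finset V} {A : Finset G.edgeSet} {e : G.edgeSet} (he : e ∈ A)
    (hS : (e : Sym2 V).toFinset ⊆ S) : freeProb S A = 0 := by
  refine orderAvg_eq_zero fun l hl => if_neg fun h => ?_
  exact not_isFree_greedyRun ((mem_iff_of_mem_orders hl).2 he) (h.mono subset_rfl hS)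

/-- A last edge `e` that touches `S` destroys the freeness of `S` exactly if the vertices of `S` and
both endpoints of `e` were free before. -/
theorem sum_freeProb_sub (S : Finset V) (A : Finset G.edgeSet) :
    ∑ e ∈ A, (freeProb S A - freeProb S (A.erase e)) =
      ∑ e ∈ A, (if Disjoint S (e : Sym2 V).toFinset then 0
        else - freeProb (S ∪ (e : Sym2 V).toFinset) (A.erase e)) := by
  rw [Finset.sum_sub_distrib, Finset.sum_const, nsmul_eq_mul]
  conv_lhs => rw [freeProb]
  rw [card_mul_orderAvg, ← Finset.sum_sub_distrib]
  refine Finset.sum_congr rfl fun e _ => ?_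
  rw [freeProb, ← orderAvg_sub]
  split_ifs with hd
  · refine orderAvg_eq_zero fun l _ => ?_
    rw [greedyRun_append]
    split_ifs <;> simp_all [isFree_insert]
  · rw [freeProb, ← orderAvg_neg]
    refine orderAvg_congr fun l _ => ?_
    rw [greedyRun_append]
    simp only [isFree_union]
    by_cases h1 : IsFree (greedyRun l) (e : Sym2 V).toFinset <;>
      by_cases h2 : IsFree (greedyRun l) S <;> simp [h1, h2, hd, isFree_insert]

theorem matchProb_eq_zero {e : G.edgeSet} {A : Finset G.edgeSet} (he : e ∉ A) :
    matchProb e A = 0 :=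
  orderAvg_eq_zero fun _ hl =>
    if_neg fun h => he ((mem_iff_of_mem_orders hl).1 (mem_of_mem_greedyRun h))

/-- A last edge is selected exactly if both its endpoints were free before, and a last edge other
than `e` does not change whether `e` is selected. -/
theorem sum_matchProb_sub (e : G.edgeSet) (A : Finset G.edgeSet) :
    ∑ e' ∈ A, (matchProb e A - matchProb e (A.erase e')) =
      ∑ e' ∈ A, (if e' = e then freeProb (e : Sym2 V).toFinset (A.erase e') else 0) := by
  rw [Finset.sum_sub_distrib, Finset.sum_const, nsmul_eq_mul]
  conv_lhs => rw [matchProb]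
  rw [card_mul_orderAvg, ← Finset.sum_sub_distrib]
  refine Finset.sum_congr rfl fun e' _ => ?_
  split_ifs with hd
  · subst hd
    rw [matchProb_eq_zero (Finset.notMem_erase e' A), sub_zero, freeProb]
    refine orderAvg_congr fun l hl => ?_
    have hn : e' ∉ greedyRun l := fun h => by
      simpa using (mem_iff_of_mem_orders hl).1 (mem_of_mem_greedyRun h)
    rw [greedyRun_append]
    split_ifs <;> simp_all
  · rw [matchProb, ← orderAvg_sub]
    refine orderAvg_eq_zero fun l _ => ?_
    rw [greedyRun_append]
    split_ifs <;> simp_all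

theorem selectionProb_greedyCRS (x : G.edgeSet → ℝ) (e : G.edgeSet) :
    selectionProb x (greedyCRS G) e = activeSetExp x (matchProb e) := by
  rw [selectionProb, activeSetExp]
  refine Finset.sum_congr rfl fun A _ => ?_
  congr 1
  rw [matchProb]
  conv_rhs => rw [← Finset.univ_inter A, ← orderAvg_filter]
  rw [← card_filter_equiv_div_card (fun l => e ∈ greedyRun (l.filter (· ∈ A)))]
  simp only [greedyCRS, foldl_greedyStep_eq_greedyRun]

end Greedy

/-! ### Free vertices at intermediate times -/

section Hierarchy

variable {V : Type u} [Fintype V] [DecidableEq V] {G : SimpleGraph V} [DecidableRel G.Adj]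

/-- The probability that the vertices of `S` are all unmatched at time `t`, when every edge arrives
at an independent uniformly random time in `[0, 1]`: the edges that have arrived by then and are
active form a random set with activation probabilities `t * x e`, in uniformly random order. -/
noncomputable def freeAt (x : G.edgeSet → ℝ) (t : ℝ) (S : Finset V) : ℝ :=
  activeSetExp (fun e => t * x e) (freeProb S)

/-- The probability that the vertices of `S` are all unmatched at time `t` if the edge `e` is
ignored. -/
noncomputable def freeAtWithout (x : G.edgeSet → ℝ) (t : ℝ) (e : G.edgeSet) (S : Finset V) : ℝ :=
  activeSetExp (Function.update (fun e => t * x e) e 0) (freeProb S)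

theorem IsOneRegular.le_one {x : G.edgeSet → ℝ} (hx : IsOneRegular x) (e : G.edgeSet) :
    x e ≤ 1 := by
  rw [← hx.2 (e : Sym2 V).out.1]
  exact Finset.single_le_sum (fun e _ => hx.1 e)
    (Finset.mem_filter.2 ⟨mem_univ e, Sym2.out_fst_mem _⟩)

theorem IsOneRegular.mul_mem_Icc {x : G.edgeSet → ℝ} (hx : IsOneRegular x) {t : ℝ} (h0 : 0 ≤ t)
    (h1 : t ≤ 1) (e : G.edgeSet) : 0 ≤ t * x e ∧ t * x e ≤ 1 :=
  ⟨mul_nonneg h0 (hx.1 e), mul_le_one₀ h1 (hx.1 e) (hx.le_one e)⟩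

theorem freeAt_nonneg {x : G.edgeSet → ℝ} (hx : IsOneRegular x) {t : ℝ} (h0 : 0 ≤ t)
    (h1 : t ≤ 1) (S : Finset V) : 0 ≤ freeAt x t S :=
  activeSetExp_nonneg (fun e => (hx.mul_mem_Icc h0 h1 e).1) (fun e => (hx.mul_mem_Icc h0 h1 e).2)
    (freeProb_nonneg S)

theorem freeAt_le_one {x : G.edgeSet → ℝ} (hx : IsOneRegular x) {t : ℝ} (h0 : 0 ≤ t)
    (h1 : t ≤ 1) (S : Finset V) : freeAt x t S ≤ 1 :=
  activeSetExp_le_one (fun e => (hx.mul_mem_Icc h0 h1 e).1) (fun e => (hx.mul_mem_Icc h0 h1 e).2)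
    (freeProb_le_one S)

theorem update_mem_Icc {x : G.edgeSet → ℝ} (hx : IsOneRegular x) {t : ℝ} (h0 : 0 ≤ t)
    (h1 : t ≤ 1) (e e' : G.edgeSet) :
    0 ≤ Function.update (fun e => t * x e) e 0 e' ∧
      Function.update (fun e => t * x e) e 0 e' ≤ 1 := by
  rcases eq_or_ne e' e with rfl | h
  · simp
  · rw [Function.update_of_ne h]
    exact hx.mul_mem_Icc h0 h1 e'

theorem freeAtWithout_nonneg {x : G.edgeSet → ℝ} (hx : IsOneRegular x) {t : ℝ} (h0 : 0 ≤ t)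
    (h1 : t ≤ 1) (e : G.edgeSet) (S : Finset V) : 0 ≤ freeAtWithout x t e S :=
  activeSetExp_nonneg (fun e' => (update_mem_Icc hx h0 h1 e e').1)
    (fun e' => (update_mem_Icc hx h0 h1 e e').2) (freeProb_nonneg S)

theorem freeAtWithout_le_one {x : G.edgeSet → ℝ} (hx : IsOneRegular x) {t : ℝ} (h0 : 0 ≤ t)
    (h1 : t ≤ 1) (e : G.edgeSet) (S : Finset V) : freeAtWithout x t e S ≤ 1 :=
  activeSetExp_le_one (fun e' => (update_mem_Icc hx h0 h1 e e').1)
    (fun e' => (update_mem_Icc hx h0 h1 e e').2) (freeProb_le_one S)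

theorem freeAt_zero (x : G.edgeSet → ℝ) (S : Finset V) : freeAt x 0 S = 1 := by
  simp only [freeAt, zero_mul]
  rw [activeSetExp_zero, freeProb_empty]

/-- The endpoints of `e` can be free only if `e` is inactive or has not arrived yet. -/
theorem freeAt_eq_mul (x : G.edgeSet → ℝ) (t : ℝ) {e : G.edgeSet} {S : Finset V}
    (hS : (e : Sym2 V).toFinset ⊆ S) :
    freeAt x t S = (1 - t * x e) * freeAtWithout x t e S :=
  activeSetExp_eq_mul_update _ fun _ he => freeProb_eq_zero he hS

theorem freeAt_le_freeAtWithout {x : G.edgeSet → ℝ} (hx : IsOneRegular x) {t : ℝ} (h0 : 0 ≤ t)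
    (h1 : t ≤ 1) {e : G.edgeSet} {S : Finset V} (hS : (e : Sym2 V).toFinset ⊆ S) :
    freeAt x t S ≤ freeAtWithout x t e S := by
  rw [freeAt_eq_mul x t hS]
  have := mul_nonneg (hx.mul_mem_Icc h0 h1 e).1 (freeAtWithout_nonneg hx h0 h1 e S)
  linarith

theorem freeAtWithout_le_freeAt_add {x : G.edgeSet → ℝ} (hx : IsOneRegular x) {t : ℝ}
    (h0 : 0 ≤ t) (h1 : t ≤ 1) {e : G.edgeSet} {S : Finset V}
    (hS : (e : Sym2 V).toFinset ⊆ S) : freeAtWithout x t e S ≤ freeAt x t S + x e := by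
  rw [freeAt_eq_mul x t hS]
  have h2 : t * x e * freeAtWithout x t e S ≤ x e * 1 :=
    mul_le_mul (mul_le_of_le_one_left (hx.1 e) h1) (freeAtWithout_le_one hx h0 h1 e S)
      (freeAtWithout_nonneg hx h0 h1 e S) (hx.1 e)
  linarith

theorem hasDerivAt_freeAt (x : G.edgeSet → ℝ) (S : Finset V) (t : ℝ) :
    HasDerivAt (fun s => freeAt x s S)
      (- ∑ e : G.edgeSet, x e * (if Disjoint S (e : Sym2 V).toFinset then 0
        else freeAtWithout x t e (S ∪ (e : Sym2 V).toFinset))) t := by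
  refine (hasDerivAt_activeSetExp x
    (h := fun e B => if Disjoint S (e : Sym2 V).toFinset then 0
        else - freeProb (S ∪ (e : Sym2 V).toFinset) B) (sum_freeProb_sub S) t).congr_deriv ?_
  rw [← Finset.sum_neg_distrib]
  refine Finset.sum_congr rfl fun e _ => ?_
  split_ifs <;> simp [activeSetExp, freeAtWithout]

theorem hasDerivAt_activeSetExp_matchProb (x : G.edgeSet → ℝ) (e : G.edgeSet) (t : ℝ) :
    HasDerivAt (fun s => activeSetExp (fun e => s * x e) (matchProb e))
      (x e * freeAtWithout x t e (e : Sym2 V).toFinset) t := by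
  refine (hasDerivAt_activeSetExp x
    (h := fun e' B => if e' = e then freeProb (e : Sym2 V).toFinset B else 0)
    (sum_matchProb_sub e) t).congr_deriv ?_
  rw [Finset.sum_eq_single e]
  · simp [freeAtWithout]
  · intro e' _ he'
    simp [he', activeSetExp]
  · simp

/-! ### The hierarchy of differential equations -/

theorem card_toFinset_edge {V : Type u} [DecidableEq V] {G : SimpleGraph V} (e : G.edgeSet) :
    #(e : Sym2 V).toFinset = 2 :=
  Sym2.card_toFinset_of_not_isDiag _ (G.not_isDiag_of_mem_edgeSet e.2)

theorem IsOneRegular.sum_card_inter_mul {x : G.edgeSet → ℝ} (hx : IsOneRegular x)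
    (S : Finset V) : ∑ e : G.edgeSet, (#(S ∩ (e : Sym2 V).toFinset) : ℝ) * x e = #S := by
  have h : ∀ e : G.edgeSet, (#(S ∩ (e : Sym2 V).toFinset) : ℝ) * x e
      = ∑ v ∈ S, if v ∈ (e : Sym2 V) then x e else 0 := by
    intro e
    rw [← Finset.sum_filter, Finset.sum_const, nsmul_eq_mul, ← Finset.filter_mem_eq_inter]
    simp only [Sym2.mem_toFinset]
  rw [Finset.sum_congr rfl fun e _ => h e, Finset.sum_comm,
    Finset.sum_congr rfl fun v _ => by rw [← Finset.sum_filter, hx.2 v]]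
  simp

theorem card_filter_subset_le (S : Finset V) :
    #{e : G.edgeSet | (e : Sym2 V).toFinset ⊆ S} ≤ (#S + 1).choose 2 := by
  rw [← Finset.card_sym2]
  refine Finset.card_le_card_of_injOn (fun e => (e : Sym2 V)) ?_ Subtype.val_injective.injOn
  intro e he
  rw [Finset.mem_coe, Finset.mem_filter] at he
  rw [Finset.mem_coe, Finset.mem_sym2_iff]
  exact fun a ha => he.2 (Sym2.mem_toFinset.2 ha)

/-- If the freeness probabilities of all sets with `#S + 1` elements are within `D` of `c`, then
that of `S` decreases at a rate close to `#S * c`: up to an error for the edges inside `S`, each of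
the vertices of `S` meets edges of total value `1`, and each of these adds one vertex. -/
theorem abs_deriv_freeAt_le {x : G.edgeSet → ℝ} (hx : IsOneRegular x) {ε : ℝ}
    (hε0 : 0 ≤ ε) (hε : ∀ e, x e ≤ ε) {t : ℝ} (h0 : 0 ≤ t) (h1 : t ≤ 1) (S : Finset V)
    {c D : ℝ} (hc0 : 0 ≤ c) (hc1 : c ≤ 1) (hD0 : 0 ≤ D)
    (hD : ∀ T : Finset V, #T = #S + 1 → |freeAt x t T - c| ≤ D) :
    |- ∑ e : G.edgeSet, x e * (if Disjoint S (e : Sym2 V).toFinset then 0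
        else freeAtWithout x t e (S ∪ (e : Sym2 V).toFinset)) + #S * c|
      ≤ #S * (D + ε) + 3 * (#S + 1).choose 2 * ε := by
  have hterm : ∀ e : G.edgeSet, |-(x e * (if Disjoint S (e : Sym2 V).toFinset then 0
        else freeAtWithout x t e (S ∪ (e : Sym2 V).toFinset)))
        + (#(S ∩ (e : Sym2 V).toFinset) : ℝ) * x e * c|
      ≤ (#(S ∩ (e : Sym2 V).toFinset) : ℝ) * x e * (D + ε)
        + (if (e : Sym2 V).toFinset ⊆ S then 3 * ε else 0) := by
    intro e
    have hxe := hx.1 e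
    have hcard := card_toFinset_edge e
    set u := freeAtWithout x t e (S ∪ (e : Sym2 V).toFinset) with hu
    have hu0 : 0 ≤ u := freeAtWithout_nonneg hx h0 h1 _ _
    have hu1 : u ≤ 1 := freeAtWithout_le_one hx h0 h1 _ _
    by_cases hd : Disjoint S (e : Sym2 V).toFinset
    · rw [if_pos hd, Finset.disjoint_iff_inter_eq_empty.1 hd]
      simp only [mul_zero, neg_zero, Finset.card_empty, Nat.cast_zero, zero_mul, add_zero,
        abs_zero, zero_add]
      split_ifs <;> positivity
    rw [if_neg hd]
    by_cases hs : (e : Sym2 V).toFinset ⊆ S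
    · rw [if_pos hs, Finset.inter_eq_right.2 hs, hcard, abs_le]
      have h2 : x e * u ≤ x e := mul_le_of_le_one_right hxe hu1
      have h3 : x e * c ≤ x e := mul_le_of_le_one_right hxe hc1
      have h4 : 0 ≤ x e * u := mul_nonneg hxe hu0
      have h5 : 0 ≤ x e * c := mul_nonneg hxe hc0
      have h6 : 0 ≤ x e * (D + ε) := mul_nonneg hxe (add_nonneg hD0 hε0)
      have h7 := hε e
      push_cast
      constructor <;> linarith
    · have hi : #(S ∩ (e : Sym2 V).toFinset) = 1 := by
        have ha : 0 < #(S ∩ (e : Sym2 V).toFinset) := by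
          rw [Finset.card_pos, Finset.nonempty_iff_ne_empty]
          exact fun h => hd (Finset.disjoint_iff_inter_eq_empty.2 h)
        have hb : #(S ∩ (e : Sym2 V).toFinset) < #(e : Sym2 V).toFinset := by
          refine Finset.card_lt_card (Finset.ssubset_iff_subset_ne.2
            ⟨Finset.inter_subset_right, fun h => hs (Finset.inter_eq_right.1 h)⟩)
        omega
      have hT : #(S ∪ (e : Sym2 V).toFinset) = #S + 1 := by
        have := Finset.card_union_add_card_inter S (e : Sym2 V).toFinset
        omega
      have h2 := abs_le.1 (hD _ hT)
      have h3 := freeAt_le_freeAtWithout hx h0 h1 (e := e) (S := S ∪ (e : Sym2 V).toFinset)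
        Finset.subset_union_right
      have h4 := freeAtWithout_le_freeAt_add hx h0 h1 (e := e)
        (S := S ∪ (e : Sym2 V).toFinset) Finset.subset_union_right
      rw [← hu] at h3 h4
      have h5 := hε e
      have h6 : |c - u| ≤ D + ε := abs_le.2 ⟨by linarith, by linarith⟩
      rw [if_neg hs, hi]
      have h7 : -(x e * u) + ((1 : ℕ) : ℝ) * x e * c = x e * (c - u) := by push_cast; ring
      rw [h7, abs_mul, abs_of_nonneg hxe]
      push_cast
      rw [one_mul, add_zero]
      exact mul_le_mul_of_nonneg_left h6 hxe
  have hsum : - ∑ e : G.edgeSet, x e * (if Disjoint S (e : Sym2 V).toFinset then 0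
        else freeAtWithout x t e (S ∪ (e : Sym2 V).toFinset)) + #S * c
      = ∑ e : G.edgeSet, (-(x e * (if Disjoint S (e : Sym2 V).toFinset then 0
        else freeAtWithout x t e (S ∪ (e : Sym2 V).toFinset)))
        + (#(S ∩ (e : Sym2 V).toFinset) : ℝ) * x e * c) := by
    rw [Finset.sum_add_distrib, Finset.sum_neg_distrib, ← Finset.sum_mul, hx.sum_card_inter_mul]
  rw [hsum]
  refine (Finset.abs_sum_le_sum_abs _ _).trans
    ((Finset.sum_le_sum fun e _ => hterm e).trans ?_)
  rw [Finset.sum_add_distrib, ← Finset.sum_mul, hx.sum_card_inter_mul, ← Finset.sum_filter,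
    Finset.sum_const, nsmul_eq_mul]
  have hE : (#{e : G.edgeSet | (e : Sym2 V).toFinset ⊆ S} : ℝ) * (3 * ε)
      ≤ 3 * (#S + 1).choose 2 * ε := by
    have h2 : (#{e : G.edgeSet | (e : Sym2 V).toFinset ⊆ S} : ℝ) ≤ (#S + 1).choose 2 := by
      exact_mod_cast card_filter_subset_le S
    have := mul_le_mul_of_nonneg_right h2 (by positivity : (0 : ℝ) ≤ 3 * ε)
    linarith
  linarith

/-- The coefficient of the largest edge value in the `j`-th error bound for sets of `k` vertices. -/
def hierarchyConst : ℕ → ℕ → ℝ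
  | 0, _ => 0
  | j + 1, k => k * (hierarchyConst j (k + 1) + 1) + 3 * (k + 1).choose 2

theorem hierarchyConst_nonneg (j k : ℕ) : 0 ≤ hierarchyConst j k := by
  induction j generalizing k with
  | zero => exact le_rfl
  | succ j ih =>
    rw [hierarchyConst]
    have := ih (k + 1)
    positivity

theorem hasDerivAt_inv_pow (a : ℝ) (k : ℕ) {s : ℝ} (hs : 1 + a * s ≠ 0) :
    HasDerivAt (fun s : ℝ => ((1 + a * s)⁻¹) ^ k) (-(a * (k * ((1 + a * s)⁻¹) ^ (k + 1)))) s := by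
  have h1 : HasDerivAt (fun s : ℝ => 1 + a * s) a s := by
    simpa using ((hasDerivAt_id s).const_mul a).const_add 1
  refine ((h1.fun_inv hs).fun_pow k).congr_deriv ?_
  rcases k with _ | k
  · simp
  · rw [Nat.add_sub_cancel, pow_succ _ (k + 1), pow_succ _ k, div_eq_mul_inv, ← inv_pow]
    ring

/-- The freeness probabilities of sets of `k` vertices nearly satisfy `F k' = - k * F (k + 1)` and
`F k 0 = 1`, so they are close to the solution `(1 + t) ^ (-k)`. The trivial bound `1` on the error
is improved by a factor `Θ` each time that the differential equations are integrated, because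
`Θ * (1 - t / Θ) ^ (-k)` has the derivative `k * (1 - t / Θ) ^ (-(k + 1))`. -/
theorem abs_freeAt_sub_le {x : G.edgeSet → ℝ} (hx : IsOneRegular x) {ε : ℝ} (hε0 : 0 ≤ ε)
    (hε : ∀ e, x e ≤ ε) {Θ : ℝ} (hΘ0 : 0 < Θ) (hΘ1 : Θ ≤ 1) (j : ℕ) (S : Finset V) {t : ℝ}
    (ht0 : 0 ≤ t) (ht : t < Θ) :
    |freeAt x t S - ((1 + t)⁻¹) ^ #S|
      ≤ Θ ^ j * ((1 - t / Θ)⁻¹) ^ #S + hierarchyConst j #S * ε := by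
  induction j generalizing S t with
  | zero =>
    have hq : 0 < 1 - t / Θ := by rw [sub_pos, div_lt_one hΘ0]; exact ht
    have h1 : (1 : ℝ) ≤ ((1 - t / Θ)⁻¹) ^ #S :=
      one_le_pow₀ ((one_le_inv₀ hq).2 (by linarith [div_nonneg ht0 hΘ0.le]))
    have h2 : 0 ≤ ((1 + t)⁻¹) ^ #S := by positivity
    have h3 : ((1 + t)⁻¹) ^ #S ≤ 1 :=
      pow_le_one₀ (by positivity) (inv_le_one_of_one_le₀ (by linarith))
    have h4 := freeAt_nonneg hx ht0 (ht.le.trans hΘ1) S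
    have h5 := freeAt_le_one hx ht0 (ht.le.trans hΘ1) S
    rw [hierarchyConst, pow_zero, one_mul, zero_mul, add_zero]
    exact (abs_le.2 ⟨by linarith, by linarith⟩ : _ ≤ (1 : ℝ)).trans h1
  | succ j ih =>
    set k := #S with hk
    have hq : ∀ s ∈ Set.Icc 0 t, 1 - s / Θ = 1 + -Θ⁻¹ * s ∧ 0 < 1 - s / Θ := fun s hs =>
      ⟨by ring, by rw [sub_pos, div_lt_one hΘ0]; exact hs.2.trans_lt ht⟩
    have hf : ∀ s ∈ Set.Icc 0 t, HasDerivAt (fun s => freeAt x s S - ((1 + 1 * s)⁻¹) ^ k)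
        (- ∑ e : G.edgeSet, x e * (if Disjoint S (e : Sym2 V).toFinset then 0
          else freeAtWithout x s e (S ∪ (e : Sym2 V).toFinset))
          + k * ((1 + s)⁻¹) ^ (k + 1)) s := by
      intro s hs
      refine ((hasDerivAt_freeAt x S s).sub
        (hasDerivAt_inv_pow 1 k (by have := hs.1; positivity))).congr_deriv ?_
      rw [one_mul, one_mul, sub_neg_eq_add]
    have hB : ∀ s ∈ Set.Icc 0 t,
        HasDerivAt
        (fun s => Θ ^ (j + 1) * ((1 + -Θ⁻¹ * s)⁻¹) ^ k + hierarchyConst (j + 1) k * ε * s)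
        (Θ ^ j * (k * ((1 + -Θ⁻¹ * s)⁻¹) ^ (k + 1)) + hierarchyConst (j + 1) k * ε) s := by
      intro s hs
      have hne : 1 + -Θ⁻¹ * s ≠ 0 := by rw [← (hq s hs).1]; exact (hq s hs).2.ne'
      have h2 : HasDerivAt (fun s => hierarchyConst (j + 1) k * ε * s)
          (hierarchyConst (j + 1) k * ε) s := by
        simpa using (hasDerivAt_id s).const_mul (hierarchyConst (j + 1) k * ε)
      refine (((hasDerivAt_inv_pow (-Θ⁻¹) k hne).const_mul (Θ ^ (j + 1))).add h2).congr_deriv ?_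
      congr 1
      rw [pow_succ]
      field_simp
    have hmain := image_norm_le_of_norm_deriv_right_le_deriv_boundary'
      (f := fun s => freeAt x s S - ((1 + 1 * s)⁻¹) ^ k)
      (fun s hs => (hf s hs).continuousAt.continuousWithinAt)
      (fun s hs => (hf s ⟨hs.1, hs.2.le⟩).hasDerivWithinAt) (a := 0) (b := t) (by
        rw [freeAt_zero]
        simp only [mul_zero, add_zero, inv_one, one_pow, sub_self, norm_zero, mul_one]
        positivity)
      (fun s hs => (hB s hs).continuousAt.continuousWithinAt)
      (fun s hs => (hB s ⟨hs.1, hs.2.le⟩).hasDerivWithinAt) ?_ (Set.right_mem_Icc.2 ht0)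
    · rw [Real.norm_eq_abs, one_mul] at hmain
      refine hmain.trans ?_
      rw [(hq t ⟨ht0, le_rfl⟩).1]
      have h2 : hierarchyConst (j + 1) k * ε * t ≤ hierarchyConst (j + 1) k * ε :=
        mul_le_of_le_one_right (mul_nonneg (hierarchyConst_nonneg _ _) hε0) (ht.le.trans hΘ1)
      linarith
    · intro s hs
      have hs' : s ∈ Set.Icc 0 t := ⟨hs.1, hs.2.le⟩
      have hs0 : 0 ≤ s := hs.1
      have hsΘ : s < Θ := hs.2.trans ht
      have hqs := (hq s hs').2
      set D := Θ ^ j * ((1 - s / Θ)⁻¹) ^ (k + 1) + hierarchyConst j (k + 1) * ε with hD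
      have hD0 : 0 ≤ D := by
        have := hierarchyConst_nonneg j (k + 1)
        positivity
      have h2 := abs_deriv_freeAt_le hx hε0 hε hs0 (hsΘ.le.trans hΘ1) S
        (c := ((1 + s)⁻¹) ^ (k + 1)) (D := D) (by positivity)
        (pow_le_one₀ (by positivity) (inv_le_one_of_one_le₀ (by linarith))) hD0
        (fun T hT => by
          have := ih T hs0 hsΘ
          rw [hT] at this
          exact this)
      rw [Real.norm_eq_abs]
      refine h2.trans (le_of_eq ?_)
      rw [hD, (hq s hs').1, hierarchyConst, ← hk]
      ring

/-! ### Selection probabilities -/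

theorem selectionProb_greedyCRS_nonneg {x : G.edgeSet → ℝ} (hx : IsOneRegular x)
    (e : G.edgeSet) : 0 ≤ selectionProb x (greedyCRS G) e := by
  rw [selectionProb_greedyCRS]
  refine activeSetExp_nonneg hx.1 hx.le_one fun A => orderAvg_nonneg fun l _ => ?_
  split_ifs <;> norm_num

/-- The selection probability of `e` is `x e` times the integral over `t` of the probability that
both endpoints of `e` are free at time `t`, which is close to `(1 + t) ^ (-2)`. -/
theorem isSelectable_greedyCRS {x : G.edgeSet → ℝ} (hx : IsOneRegular x) {ε : ℝ} (hε0 : 0 ≤ ε)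
    (hε : ∀ e, x e ≤ ε) {τ Θ : ℝ} (hτ0 : 0 ≤ τ) (hτ : τ < Θ) (hΘ1 : Θ ≤ 1) (j : ℕ) :
    IsSelectable x (greedyCRS G)
      (1 / 2 - ((1 - τ) + Θ ^ j * ((1 - τ / Θ)⁻¹) ^ 2 + hierarchyConst j 2 * ε)) := by
  intro e
  have hΘ0 : 0 < Θ := hτ0.trans_lt hτ
  have hτ1 : τ ≤ 1 := hτ.le.trans hΘ1
  set δ := Θ ^ j * ((1 - τ / Θ)⁻¹) ^ 2 + hierarchyConst j 2 * ε with hδ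
  have hqτ : 0 < 1 - τ / Θ := by rw [sub_pos, div_lt_one hΘ0]; exact hτ
  have hδ0 : 0 ≤ δ := by have := hierarchyConst_nonneg j 2; positivity
  -- `m s` is the probability that `e` is selected by time `s`
  set m := fun s => activeSetExp (fun e => s * x e) (matchProb e) with hm
  have hm0 : m 0 = 0 := by
    simp only [hm, zero_mul]
    rw [activeSetExp_zero, matchProb_eq_zero (Finset.notMem_empty e)]
  have hm1 : m 1 = selectionProb x (greedyCRS G) e := by
    rw [selectionProb_greedyCRS]
    simp only [hm, one_mul]
  have hxe := hx.1 e
  have hmono1 : m τ ≤ m 1 := by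
    refine monotoneOn_of_hasDerivWithinAt_nonneg (convex_Icc τ 1)
      (fun s _ => (hasDerivAt_activeSetExp_matchProb x e s).continuousAt.continuousWithinAt)
      (fun s _ => (hasDerivAt_activeSetExp_matchProb x e s).hasDerivWithinAt) (fun s hs => ?_)
      (Set.left_mem_Icc.2 hτ1) (Set.right_mem_Icc.2 hτ1) hτ1
    rw [interior_Icc] at hs
    exact mul_nonneg hxe (freeAtWithout_nonneg hx (hτ0.trans hs.1.le) hs.2.le _ _)
  have hd : ∀ s ∈ Set.Icc 0 τ, HasDerivAt
      (fun s => m s - x e * (-((1 + 1 * s)⁻¹) ^ 1 - δ * s))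
      (x e * freeAtWithout x s e (e : Sym2 V).toFinset - x e * (((1 + s)⁻¹) ^ 2 - δ)) s := by
    intro s hs
    have h2 : HasDerivAt (fun s => δ * s) δ s := by
      simpa using (hasDerivAt_id s).const_mul δ
    refine ((hasDerivAt_activeSetExp_matchProb x e s).sub (((hasDerivAt_inv_pow 1 1
      (by have := hs.1; positivity)).neg.sub h2).const_mul (x e))).congr_deriv ?_
    simp
  -- `-(1 + s)⁻¹ - δ * s` is an antiderivative of the lower bound `(1 + s)⁻² - δ`
  have hmono2 : m 0 - x e * (-((1 + 1 * (0 : ℝ))⁻¹) ^ 1 - δ * 0)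
      ≤ m τ - x e * (-((1 + 1 * τ)⁻¹) ^ 1 - δ * τ) := by
    refine monotoneOn_of_hasDerivWithinAt_nonneg (convex_Icc 0 τ)
      (fun s hs => (hd s hs).continuousAt.continuousWithinAt)
      (fun s hs => (hd s (interior_subset hs)).hasDerivWithinAt) (fun s hs => ?_)
      (Set.left_mem_Icc.2 hτ0) (Set.right_mem_Icc.2 hτ0) hτ0
    rw [interior_Icc] at hs
    rw [← mul_sub]
    refine mul_nonneg hxe ?_
    have h3 := freeAt_le_freeAtWithout hx hs.1.le (hs.2.le.trans hτ1) (e := e)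
      (S := (e : Sym2 V).toFinset) subset_rfl
    have h4 := (abs_le.1 (abs_freeAt_sub_le hx hε0 hε hΘ0 hΘ1 j (e : Sym2 V).toFinset hs.1.le
      (hs.2.trans hτ))).1
    rw [card_toFinset_edge] at h4
    have h5 : ((1 - s / Θ)⁻¹) ^ 2 ≤ ((1 - τ / Θ)⁻¹) ^ 2 := by
      have : s / Θ ≤ τ / Θ := div_le_div_of_nonneg_right hs.2.le hΘ0.le
      have h6 : 0 < 1 - s / Θ := by linarith
      gcongr
    have h6 : Θ ^ j * ((1 - s / Θ)⁻¹) ^ 2 ≤ Θ ^ j * ((1 - τ / Θ)⁻¹) ^ 2 :=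
      mul_le_mul_of_nonneg_left h5 (by positivity)
    linarith
  have h7 : (1 + τ)⁻¹ ≤ 1 / 2 + (1 - τ) := by
    rw [inv_le_iff_one_le_mul₀ (by linarith)]
    nlinarith
  have h8 : δ * τ ≤ δ := mul_le_of_le_one_right hδ0 hτ1
  have h9 : (1 / 2 - (1 - τ + δ)) * x e ≤ (1 - (1 + τ)⁻¹ - δ * τ) * x e :=
    mul_le_mul_of_nonneg_right (by linarith) hxe
  rw [hm0] at hmono2
  simp only [mul_zero, add_zero, inv_one, pow_one, one_mul, sub_zero] at hmono2
  rw [← hm1, add_assoc, ← hδ]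
  linarith

end Hierarchy

/-! ### The error function -/

theorem IsSelectable.mono {V : Type u} [Fintype V] [DecidableEq V] {G : SimpleGraph V}
    [DecidableRel G.Adj] {x : G.edgeSet → ℝ} {S : SelectionRule G} {c d : ℝ}
    (h : IsSelectable x S d) (hx : IsOneRegular x) (hcd : c ≤ d) : IsSelectable x S c :=
  fun e => (mul_le_mul_of_nonneg_right hcd (hx.1 e)).trans (h e)

/-- For every 1-regular input with edge values at most `ε`, the greedy scheme is
`(1 / 2 - δ)`-selectable. -/
def IsUniformLoss (ε δ : ℝ) : Prop :=
  ∀ (V : Type u) [Fintype V] [DecidableEq V] (G : SimpleGraph V) [DecidableRel G.Adj]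
    (x : G.edgeSet → ℝ), IsOneRegular x → (∀ e, x e ≤ ε) →
      IsSelectable x (greedyCRS G) (1 / 2 - δ)

theorem exists_isUniformLoss {η : ℝ} (hη : 0 < η) :
    ∃ ε₀ : ℝ, 0 < ε₀ ∧ ∀ ε ≤ ε₀, IsUniformLoss.{u} ε η := by
  set a := min η 1 with ha
  have ha0 : 0 < a := lt_min hη one_pos
  have ha1 : a ≤ 1 := min_le_right _ _
  have haη : a ≤ η := min_le_left _ _
  -- the three error terms are made at most `a / 3` each: the first by the choice of `τ`, the second
  -- by that of `j`, the third by that of `ε₀`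
  set τ := 1 - a / 3 with hτ
  set Θ := 1 - a / 6 with hΘ
  have hlim : Tendsto (fun j : ℕ => Θ ^ j * ((1 - τ / Θ)⁻¹) ^ 2) atTop (𝓝 0) := by
    have := (tendsto_pow_atTop_nhds_zero_of_lt_one (r := Θ) (by linarith) (by linarith)).mul_const
      (((1 - τ / Θ)⁻¹) ^ 2)
    rwa [zero_mul] at this
  obtain ⟨j, hj⟩ := (hlim.eventually (gt_mem_nhds (show 0 < a / 3 by positivity))).exists
  have hC := hierarchyConst_nonneg j 2
  refine ⟨a / 3 / (hierarchyConst j 2 + 1), by positivity, ?_⟩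
  intro ε hε V _ _ G _ x hx hxε
  refine (isSelectable_greedyCRS hx (ε := a / 3 / (hierarchyConst j 2 + 1)) (by positivity)
    (fun e => (hxε e).trans hε) (τ := τ) (Θ := Θ) (by linarith) (by linarith) (by linarith)
    j).mono hx ?_
  have h2 : hierarchyConst j 2 * (a / 3 / (hierarchyConst j 2 + 1)) ≤ a / 3 := by
    rw [mul_div_assoc', div_le_iff₀ (by positivity)]
    nlinarith
  linarith

/-- The smallest loss against `1 / 2` that the greedy scheme suffers on 1-regular inputs with edge
values at most `ε`, cut off below at `0`. -/
noncomputable def greedyLoss (ε : ℝ) : ℝ := sInf {δ : ℝ | 0 ≤ δ ∧ IsUniformLoss.{u} ε δ}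

theorem greedyLoss_nonneg (ε : ℝ) : 0 ≤ greedyLoss.{u} ε :=
  Real.sInf_nonneg fun _ h => h.1

theorem greedyLoss_le {ε δ : ℝ} (h0 : 0 ≤ δ) (h : IsUniformLoss.{u} ε δ) :
    greedyLoss.{u} ε ≤ δ :=
  csInf_le ⟨0, fun _ h => h.1⟩ ⟨h0, h⟩

/-- The infimum in the definition of `greedyLoss` is attained. -/
theorem isUniformLoss_greedyLoss (ε : ℝ) : IsUniformLoss.{u} ε (greedyLoss.{u} ε) := by
  intro V _ _ G _ x hx hxε e
  have hne : {δ : ℝ | 0 ≤ δ ∧ IsUniformLoss.{u} ε δ}.Nonempty := by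
    refine ⟨1 / 2, by norm_num, ?_⟩
    intro V _ _ G _ x hx _ e
    rw [sub_self, zero_mul]
    exact selectionProb_greedyCRS_nonneg hx e
  refine le_of_forall_pos_le_add fun η hη => ?_
  obtain ⟨δ, hδ, hlt⟩ := exists_lt_of_csInf_lt hne (lt_add_of_pos_right (greedyLoss.{u} ε) hη)
  have h1 := hδ.2 V G x hx hxε e
  have h2 : (δ - greedyLoss.{u} ε) * x e ≤ η * 1 :=
    mul_le_mul (by linarith) (hx.le_one e) (hx.1 e) hη.le
  linarith

theorem tendsto_greedyLoss : Tendsto greedyLoss.{u} (𝓝 0) (𝓝 0) := by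
  rw [Metric.tendsto_nhds_nhds]
  intro η hη
  obtain ⟨ε₀, hε₀, h⟩ := exists_isUniformLoss.{u} (half_pos hη)
  refine ⟨ε₀, hε₀, fun ε hε => ?_⟩
  rw [Real.dist_eq, sub_zero] at hε ⊢
  rw [abs_of_nonneg (greedyLoss_nonneg ε)]
  have := greedyLoss_le (half_pos hη).le (h ε (abs_lt.1 hε).2.le)
  linarith

end RandomOrderCRS

theorem theorem3 :
    -- the greedy rule is a contention resolution scheme that works online, on every finite graph
    (∀ (V : Type u) [Fintype V] [DecidableEq V] (G : SimpleGraph V) [DecidableRel G.Adj],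
      RandomOrderCRS.IsOnlineCRS (RandomOrderCRS.greedyCRS G)) ∧
    -- it is 1/2-selectable in the vanishing regime, with an error that depends only on
    -- the largest edge value
    (∃ f : ℝ → ℝ, Tendsto f (𝓝[>] 0) (𝓝 0) ∧
      ∀ (V : Type u) [Fintype V] [DecidableEq V] (G : SimpleGraph V) [DecidableRel G.Adj]
        (x : G.edgeSet → ℝ), RandomOrderCRS.IsOneRegular x →
          RandomOrderCRS.IsSelectable x (RandomOrderCRS.greedyCRS G) (1 / 2 - f (⨆ e, x e))) ∧
    -- it is 1/2-selectable on every sequence of 1-regular inputs with vanishing edge values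
    (∀ (V : ℕ → Type u) [∀ n, Fintype (V n)] [∀ n, DecidableEq (V n)]
      (G : (n : ℕ) → SimpleGraph (V n)) [∀ n, DecidableRel (G n).Adj]
      (x : (n : ℕ) → (G n).edgeSet → ℝ),
      (∀ n, RandomOrderCRS.IsOneRegular (x n)) → RandomOrderCRS.HasVanishingEdgeValues x →
        ∃ c : ℕ → ℝ, Tendsto c atTop (𝓝 (1 / 2)) ∧
          ∀ n, RandomOrderCRS.IsSelectable (x n) (RandomOrderCRS.greedyCRS (G n)) (c n)) := by
  refine ⟨fun V _ _ G _ => RandomOrderCRS.isOnlineCRS_greedyCRS,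
    ⟨RandomOrderCRS.greedyLoss.{u}, RandomOrderCRS.tendsto_greedyLoss.mono_left nhdsWithin_le_nhds,
      fun V _ _ G _ x hx => RandomOrderCRS.isUniformLoss_greedyLoss _ V G x hx
        fun e => le_ciSup (Set.finite_range x).bddAbove e⟩, ?_⟩
  rintro V _ _ G _ x hx ⟨ε, hε, hxε⟩
  refine ⟨fun n => 1 / 2 - RandomOrderCRS.greedyLoss.{u} (ε n), ?_,
    fun n => RandomOrderCRS.isUniformLoss_greedyLoss (ε n) (V n) (G n) (x n) (hx n) (hxε n)⟩
  have h := (RandomOrderCRS.tendsto_greedyLoss.{u}.comp hε).const_sub (1 / 2)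
  rwa [sub_zero] at h
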